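/- Model. Let $V$ be a set of $n$ nodes. In an $r$-round randomized algorithm in the $B$-CONGEST model (KT1), node $v$ initially knows its identifier, the identifiers of its neighbors in the communication graph $G=(V,E)$, its local input, and private random coins, independent of those of the other nodes; in each of the $r$ rounds it sends to each neighbor a $B$-bit message (or nothing), determined by what it knows and has received before; after $r$ rounds it computes a local output from what it knows and has received. Let $\mathcal X$ be the set of admissible input configurations. For sets $F_1,\dots,F_r\subseteq E$ and $x\in\mathcal X$, let $\mathrm{View}_{G,\mathcal A}((F_1,\dots,F_r),x)$ be the random vector of the messages sent, in both directions, over each edge of $F_i$ in round $i$, for $1\le i\le r$. The algorithm $\mathcal A$ is $f$-mobile-secure (on $G$, $\mathcal X$) if for all $F_1,\dots,F_r$ with $|F_i|\le f$ and all $x_1,x_2\in\mathcal X$ the distributions of $\mathrm{View}_{G,\mathcal A}((F_1,\dots,F_r),x_1)$ and $\mathrm{View}_{G,\mathcal A}((F_1,\dots,F_r),x_2)$ are equal; it is $f$-static-secure if this holds whenever $F_1=\dots=F_r$. Two algorithms are equivalent if for every input in $\mathcal X$ the joint distributions of the outputs of all nodes are equal. Theorem. Let $\mathcal A$ be an $r$-round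 algorithm with $B$-bit messages, where $B=O(\log n)$ and $r\le\mathrm{poly}(n)$, and let $f\ge 0$ be an integer. In each of the following cases there is an $r'$-round algorithm $\mathcal A'$ with $B'$-bit messages, $B'=O(\log n)$, such that for every graph $G$ on $V$ and every input domain $\mathcal X$ for which $\mathcal A$ is $f$-static-secure, $\mathcal A'$ is equivalent to $\mathcal A$ and $f'$-mobile-secure: 1. for every integer $t\ge 1$, with $r'=2r+t$ and $f'=\left\lfloor \frac{f(t+1)}{r+t}\right\rfloor$; 2. for every integer $t\ge 2fr$, with $r'=2r+t$ and $f'=f$. Consequently this is also possible 3. with some $r'=O(r)$ and $f'=\Theta(f)$; 4. if $f\ge 1$, with some $r'=O(fr)$ and $f'=f$. The constants hidden in $O(r)$, $\Theta(f)$ and $O(fr)$ in 3 and 4 are absolute; the constant in $B'=O(\log n)$ depends only on those in $B=O(\log n)$ and $r\le\mathrm{poly}(n)$, and in particular not on $t$ or $f$. -/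

import Mathlib

/-- What is sent in one direction of an edge in one round when the bandwidth is `B`: either a
`B`-bit message, or nothing (`none`). -/
abbrev Msg (B : ℕ) : Type := Option (Fin B → Bool)

theorem tsum_pi_prod {V : Type*} [Fintype V] {C : V → Type*} (p : ∀ v, C v → ENNReal) :
    ∑' ω : (∀ v, C v), ∏ v, p v (ω v) = ∏ v, ∑' c, p v c := by
  revert C
  refine Fintype.induction_empty_option
    (P := fun V _ => ∀ {C : V → Type _} (p : ∀ v, C v → ENNReal),
      ∑' ω : (∀ v, C v), ∏ v, p v (ω v) = ∏ v, ∑' c, p v c) ?_ ?_ ?_ V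
  · intro α β _ e ih C p
    let _ := Fintype.ofEquiv β e.symm
    rw [← (Equiv.piCongrLeft C e).tsum_eq, ← Equiv.prod_comp e]
    rw [← ih fun a => p (e a)]
    refine tsum_congr fun ω => ?_
    rw [← Equiv.prod_comp e]
    exact Finset.prod_congr rfl fun a _ => by rw [Equiv.piCongrLeft_apply_apply]
  · intro C p
    simp
  · intro α _ ih C p
    rw [← (Equiv.piOptionEquivProd (β := C)).symm.tsum_eq, ENNReal.tsum_prod']
    simp only [Fintype.prod_option]
    rw [← ih fun a => p (some a), ← ENNReal.tsum_mul_right]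
    refine tsum_congr fun a => ?_
    rw [← ENNReal.tsum_mul_left]
    rfl

/-- The joint distribution of independent random variables, one per index `v`, the one with
index `v` being distributed according to `p v`. -/
noncomputable def PMF.indep {V : Type*} [Fintype V] {C : V → Type*} (p : ∀ v, PMF (C v)) :
    PMF (∀ v, C v) :=
  ⟨fun ω => ∏ v, p v (ω v), by
    have h : ∑' ω : (∀ v, C v), ∏ v, p v (ω v) = 1 := by
      rw [tsum_pi_prod fun v => ⇑(p v)]
      simp [PMF.tsum_coe]
    exact h ▸ ENNReal.summable.hasSum⟩

/-- A randomized `r`-round distributed algorithm for the node (identifier) set `V` in the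
synchronous `B`-CONGEST model, in the KT1 setting. The type of local inputs of node `v` is `I v`
and the type of its local outputs is `O v`.

Node `v` holds private random coins, drawn from `coin v` and independent of the coins of all
other nodes. Initially it knows its own identifier `v` and the set `N` of identifiers of its
neighbors. What it sends to each neighbor in round `i` depends only on `v`, `N`, its input, its
coins, and on what it received from its neighbors in the rounds `j < i`; its output depends on
the same data after all `r` rounds. -/
structure CongestAlg {V : Type*} (I O : V → Type*) (B r : ℕ) where
  Coin : V → Type
  coin : ∀ v, PMF (Coin v)
  send : ∀ (v : V) (N : Set V), I v → Coin v → ∀ i : Fin r, (Fin i → N → Msg B) → N → Msg B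
  output : ∀ (v : V) (N : Set V), I v → Coin v → (Fin r → N → Msg B) → O v

namespace CongestAlg

variable {V : Type*} {I O : V → Type*} {B B' r r' : ℕ}

/-- `A.sent G x ω i u v h` is what `u` sends to its neighbor `v` in round `i` of the execution of
`A` on the graph `G` with inputs `x` and coins `ω`. -/
def sent (A : CongestAlg I O B r) (G : SimpleGraph V) (x : ∀ v, I v) (ω : ∀ v, A.Coin v)
    (i : Fin r) (u v : V) (h : G.Adj u v) : Msg B :=
  A.send u (G.neighborSet u) (x u) (ω u) i
    (fun j w => sent A G x ω ⟨j, j.isLt.trans i.isLt⟩ w.1 u (G.adj_symm w.2)) ⟨v, h⟩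
  termination_by i.val
  decreasing_by exact j.isLt

/-- The outputs of all nodes in the execution with inputs `x` and coins `ω`. -/
def outputs (A : CongestAlg I O B r) (G : SimpleGraph V) (x : ∀ v, I v) (ω : ∀ v, A.Coin v) :
    ∀ v, O v :=
  fun v => A.output v (G.neighborSet v) (x v) (ω v)
    fun i w => A.sent G x ω i w.1 v (G.adj_symm w.2)

/-- The joint distribution of the outputs of all nodes on inputs `x`. -/
noncomputable def outputLaw [Fintype V] (A : CongestAlg I O B r) (G : SimpleGraph V)
    (x : ∀ v, I v) : PMF (∀ v, O v) :=
  (PMF.indep A.coin).map (A.outputs G x)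

/-- The view of an eavesdropper that listens over the edges `F i` of `G` in round `i`: for every
round `i` and every edge in `F i`, the messages sent over the edge in round `i`, in both
directions. -/
def view (A : CongestAlg I O B r) (G : SimpleGraph V) (F : Fin r → Finset G.edgeSet)
    (x : ∀ v, I v) (ω : ∀ v, A.Coin v) :
    ∀ i : Fin r, {d : G.Dart // (⟨d.edge, d.edge_mem⟩ : G.edgeSet) ∈ F i} → Msg B :=
  fun i d => A.sent G x ω i d.1.fst d.1.snd d.1.adj

/-- The distribution of the view of the eavesdropper on inputs `x`. -/
noncomputable def viewLaw [Fintype V] (A : CongestAlg I O B r) (G : SimpleGraph V)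
    (F : Fin r → Finset G.edgeSet) (x : ∀ v, I v) :
    PMF (∀ i : Fin r, {d : G.Dart // (⟨d.edge, d.edge_mem⟩ : G.edgeSet) ∈ F i} → Msg B) :=
  (PMF.indep A.coin).map (A.view G F x)

/-- `A` is `f`-static-secure on `G` with input domain `X`: an eavesdropper that listens over the
same at most `f` edges in all rounds has a view whose distribution does not depend on the
input. -/
def StaticSecure [Fintype V] (A : CongestAlg I O B r) (G : SimpleGraph V) (X : Set (∀ v, I v))
    (f : ℕ) : Prop :=
  ∀ F : Finset G.edgeSet, F.card ≤ f → ∀ x₁ ∈ X, ∀ x₂ ∈ X,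
    A.viewLaw G (fun _ => F) x₁ = A.viewLaw G (fun _ => F) x₂

/-- `A` is `f`-mobile-secure on `G` with input domain `X`: an eavesdropper that listens in each
round `i` over a set `F i` of at most `f` edges has a view whose distribution does not depend on
the input. -/
def MobileSecure [Fintype V] (A : CongestAlg I O B r) (G : SimpleGraph V) (X : Set (∀ v, I v))
    (f : ℕ) : Prop :=
  ∀ F : Fin r → Finset G.edgeSet, (∀ i, (F i).card ≤ f) → ∀ x₁ ∈ X, ∀ x₂ ∈ X,
    A.viewLaw G F x₁ = A.viewLaw G F x₂

/-- Two algorithms, possibly with different bandwidths and numbers of rounds, are equivalent on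
`G` with input domain `X`: on every input the joint output distributions agree. -/
def Equivalent [Fintype V] (A : CongestAlg I O B r) (A' : CongestAlg I O B' r')
    (G : SimpleGraph V) (X : Set (∀ v, I v)) : Prop :=
  ∀ x ∈ X, A'.outputLaw G x = A.outputLaw G x

/-- `A'` is a secure mobile version of the `f`-static-secure algorithm `A`: on every graph and
for every input domain for which `A` is `f`-static-secure, `A'` is equivalent to `A` and
`f'`-mobile-secure. In particular `A'` is determined without knowledge of the graph. -/
def MobileSimulates [Fintype V] (A' : CongestAlg I O B' r') (f' : ℕ) (A : CongestAlg I O B r)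
    (f : ℕ) : Prop :=
  ∀ (G : SimpleGraph V) (X : Set (∀ v, I v)), A.StaticSecure G X f →
    A.Equivalent A' G X ∧ A'.MobileSecure G X f'

end CongestAlg

/-! `A` is run under one-time pads. In `r + t` key rounds every node sends each neighbor uniform
elements of a prime field, and Vandermonde forms extract `r` keys from them. With any `t` elements
fixed, the remaining `r` determine the keys bijectively, so an edge observed in at most `t` key
rounds has uniform keys given what was seen there.

By averaging (`card_filter_lt_card_le`) at most `f` edges are observed more often. Static security
of `A` protects this set `D`; on the other edges the plaintext is absorbed by translating the pads
(`exists_view_padded`). The view is thus a randomized function of the static view of `A` on `D`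
(`viewLaw_padded`). As there are at most `n ^ 2` edges, `2 * n ^ 2 * r` extra key rounds always
suffice, so the field stays polynomial in `n` for every `t`. -/

namespace PMF

/-! ### Independent products of distributions. -/

theorem indep_apply {V : Type*} [Fintype V] {C : V → Type*} (p : ∀ v, PMF (C v))
    (ω : ∀ v, C v) : indep p ω = ∏ v, p v (ω v) := rfl

theorem bind_map_prodMk_apply {α β : Type*} (p : PMF α) (q : PMF β) (x : α × β) :
    (p.bind fun a => q.map (Prod.mk a)) x = p x.1 * q x.2 := by
  classical
  obtain ⟨a, b⟩ := x
  rw [PMF.bind_apply, tsum_eq_single a]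
  · rw [PMF.map_apply, tsum_eq_single b]
    · simp
    · intro b' hb
      simp [hb.symm]
  · intro a' ha
    rw [PMF.map_apply]
    simp [ha.symm]

/-- Independent pairs of independent random variables are drawn by drawing all first components
and then, independently, all second components. -/
theorem indep_bind_map_prodMk {V : Type*} [Fintype V] {C D : V → Type*} (p : ∀ v, PMF (C v))
    (q : ∀ v, PMF (D v)) :
    indep (fun v => (p v).bind fun a => (q v).map (Prod.mk a)) =
      (indep p).bind fun a => (indep q).map fun b v => (a v, b v) := by
  have key : ((indep p).bind fun a => (indep q).map fun b v => (a v, b v)) =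
      ((indep p).bind fun a => (indep q).map (Prod.mk a)).map
        (Equiv.arrowProdEquivProdArrow V C D).symm := by
    rw [PMF.map_bind]
    refine congrArg _ (funext fun a => ?_)
    rw [PMF.map_comp]
    rfl
  rw [key]
  ext ω
  rw [PMF.map_apply, tsum_eq_single (Equiv.arrowProdEquivProdArrow V C D ω)]
  · rw [if_pos (Equiv.symm_apply_apply _ ω).symm, bind_map_prodMk_apply, indep_apply, indep_apply, indep_apply,
      ← Finset.prod_mul_distrib]
    exact Finset.prod_congr rfl fun v _ => bind_map_prodMk_apply _ _ _
  · intro y hy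
    rw [if_neg]
    rintro rfl
    exact hy (by simp)

theorem indep_uniform_map_add {V : Type*} [Fintype V] {K : V → Type*} [∀ v, AddGroup (K v)]
    [∀ v, Fintype (K v)] (δ : ∀ v, K v) :
    (indep fun v => uniformOfFintype (K v)).map (fun R => R + δ) =
      indep fun v => uniformOfFintype (K v) := by
  ext ω
  rw [PMF.map_apply, tsum_eq_single (ω - δ)]
  · simp [indep_apply]
  · intro y hy
    rw [if_neg]
    rintro rfl
    exact hy (by simp)

end PMF

/-! ### Key extraction. -/

/-- A family of linear forms, given by the powers of pairwise distinct field elements, from which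
no information leaks if at most `t` of the `r + t` summands are revealed. -/
theorem exists_vanishing_vandermonde {K : Type*} [Field K] {r t : ℕ} {α : Fin (r + t) → K}
    (hα : Function.Injective α) {S : Finset (Fin (r + t))} (hS : S.card ≤ t) (k : Fin r → K) :
    ∃ ρ : Fin (r + t) → K, (∀ i ∈ S, ρ i = 0) ∧ ∀ j : Fin r, ∑ i, ρ i * α i ^ (j : ℕ) = k j := by
  have hc : r ≤ Sᶜ.card := by
    rw [Finset.card_compl, Fintype.card_fin]
    omega
  obtain ⟨S', hS', hcard⟩ := Finset.exists_subset_card_eq hc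
  set e := S'.orderEmbOfFin hcard with he
  have heS : ∀ a, e a ∉ S := fun a =>
    Finset.mem_compl.1 (hS' (Finset.orderEmbOfFin_mem S' hcard a))
  -- At least `r` indices avoid `S`; on `r` of them the system is square and invertible, and its
  -- solution is extended by zero.
  set W : Matrix (Fin r) (Fin r) K := Matrix.vandermonde (α ∘ e) with hW
  have hdet : IsUnit W.det :=
    (Matrix.det_vandermonde_ne_zero_iff.2 (hα.comp e.injective)).isUnit
  set y := Matrix.vecMul k W⁻¹ with hy
  have hyW : Matrix.vecMul y W = k := by
    rw [hy, Matrix.vecMul_vecMul, Matrix.nonsing_inv_mul _ hdet, Matrix.vecMul_one]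
  refine ⟨Function.extend e y 0, fun i hi => ?_, fun j => ?_⟩
  · rw [Function.extend_apply']
    · rfl
    · rintro ⟨a, rfl⟩
      exact heS a hi
  · rw [← congrFun hyW j]
    have : ∑ a : Fin r, Function.extend e y 0 (e a) * α (e a) ^ (j : ℕ) =
        ∑ i, Function.extend e y 0 i * α i ^ (j : ℕ) := by
      refine Finset.sum_of_injOn e e.injective.injOn (by simp) ?_ (by simp)
      intro i _ hi
      rw [Function.extend_apply']
      · simp
      · rintro ⟨a, rfl⟩
        exact hi ⟨a, by simp⟩
    rw [← this]
    simp [Matrix.vecMul, dotProduct, hW, Matrix.vandermonde_apply, e.injective.extend_apply]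

/-- A one-time pad over the group `K` for `r` messages of `B` bits each, whose keys are extracted
from `s` random group elements so that revealing `t` of these elements reveals nothing about the
keys. Group elements are transmitted as messages of `B'` bits. -/
structure PadScheme (B B' r s t : ℕ) (K : Type) [AddCommGroup K] where
  enc : Msg B → K
  dec : K → Msg B
  dec_enc : ∀ m, dec (enc m) = m
  toMsg : K → Msg B'
  ofMsg : Msg B' → K
  ofMsg_toMsg : ∀ k, ofMsg (toMsg k) = k
  extract : (Fin s → K) →+ (Fin r → K)
  exists_extract_eq : ∀ S : Finset (Fin s), S.card ≤ t → ∀ k : Fin r → K,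
    ∃ ρ : Fin s → K, (∀ i ∈ S, ρ i = 0) ∧ extract ρ = k

/-! ### The compiled algorithm and its correctness. -/

namespace CongestAlg

variable {V : Type*} {I O : V → Type*} {B B' r s t T : ℕ} {K : Type}

theorem sent_eq (A : CongestAlg I O B r) (G : SimpleGraph V) (x : ∀ v, I v)
    (ω : ∀ v, A.Coin v) (i : Fin r) (u v : V) (h : G.Adj u v) :
    A.sent G x ω i u v h = A.send u (G.neighborSet u) (x u) (ω u) i
      (fun j w => A.sent G x ω ⟨j, j.isLt.trans i.isLt⟩ w.1 u (G.adj_symm w.2)) ⟨v, h⟩ := by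
  rw [sent]

variable [Fintype V] [AddCommGroup K] [Fintype K]

/-- The compiled algorithm: for `s` rounds all nodes send independent uniform elements of `K` to
each of their neighbors; in the next `r` rounds they execute `A`, encrypting the messages by the
keys extracted from these elements; then they remain silent. -/
noncomputable def padded (A : CongestAlg I O B r) (P : PadScheme B B' r s t K)
    (hT : s + r ≤ T) : CongestAlg I O B' T where
  Coin v := A.Coin v × (Fin (Fintype.card V) → Fin s → K)
  coin v := (A.coin v).bind fun a => (PMF.uniformOfFintype _).map (Prod.mk a)
  send v N x c i received w :=
    if h₁ : i.val < s then P.toMsg (c.2 (Fintype.equivFin V w) ⟨i, h₁⟩)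
    else if h₂ : i.val - s < r then
      P.toMsg (P.enc (A.send v N x c.1 ⟨i - s, h₂⟩
        (fun j z => P.dec (P.ofMsg (received ⟨s + j, by have : j.val < i.val - s := j.isLt; omega⟩ z) -
          P.extract (fun k => P.ofMsg (received ⟨k, by omega⟩ z))
            ⟨j, by have : j.val < i.val - s := j.isLt; omega⟩)) w) +
        P.extract (c.2 (Fintype.equivFin V w)) ⟨i - s, h₂⟩)
    else none
  output v N x c received :=
    A.output v N x c.1 fun j z =>
      P.dec (P.ofMsg (received ⟨s + j, by omega⟩ z) -
        P.extract (fun k => P.ofMsg (received ⟨k, by omega⟩ z)) j)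

variable (A : CongestAlg I O B r) (P : PadScheme B B' r s t K) (hT : s + r ≤ T)
  (G : SimpleGraph V) (x : ∀ v, I v) (ω : ∀ v, A.Coin v)
  (R : V → Fin (Fintype.card V) → Fin s → K)

/-- Coins of the compiled algorithm, assembled from coins of `A` and random pads. -/
def padCoins (A : CongestAlg I O B r) (P : PadScheme B B' r s t K) (hT : s + r ≤ T)
    (ω : ∀ v, A.Coin v) (R : V → Fin (Fintype.card V) → Fin s → K) :
    ∀ v, (A.padded P hT).Coin v :=
  fun v => (ω v, R v)

theorem sent_padded_castLE (i : Fin s) {u v : V} (h : G.Adj u v) :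
    (A.padded P hT).sent G x (A.padCoins P hT ω R) ⟨i, by omega⟩ u v h =
      P.toMsg (R u (Fintype.equivFin V v) i) := by
  rw [sent_eq]
  simp [padded, padCoins]

theorem sent_padded_of_sub_lt {i : Fin T} (h₁ : ¬ i.val < s) (h₂ : i.val - s < r) {u v : V}
    (h : G.Adj u v) :
    (A.padded P hT).sent G x (A.padCoins P hT ω R) i u v h =
      P.toMsg (P.enc (A.sent G x ω ⟨i - s, h₂⟩ u v h) +
        P.extract (R u (Fintype.equivFin V v)) ⟨i - s, h₂⟩) := by
  obtain ⟨i, hi⟩ := i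
  induction i using Nat.strong_induction_on generalizing u v with
  | _ i ih =>
    -- By induction, decryption has recovered the earlier messages of `A`, so `A.send` is fed its
    -- genuine history.
    have hdec : ∀ (j : Fin (i - s)) (w : G.neighborSet u),
        P.dec (P.ofMsg ((A.padded P hT).sent G x (A.padCoins P hT ω R)
            ⟨s + j, by have := j.isLt; simp only at h₁ h₂; omega⟩ w.1 u (G.adj_symm w.2)) -
          P.extract (fun k => P.ofMsg ((A.padded P hT).sent G x (A.padCoins P hT ω R)
            ⟨k, by omega⟩ w.1 u (G.adj_symm w.2))) ⟨j, j.isLt.trans h₂⟩) =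
        A.sent G x ω ⟨j, j.isLt.trans h₂⟩ w.1 u (G.adj_symm w.2) := by
      intro j w
      have hj := j.isLt
      simp only at h₁ h₂
      have h₃ : ¬ s + j.val < s := by omega
      have h₄ : s + j.val - s < r := by omega
      rw [ih (s + j) (by omega) (G.adj_symm w.2) (by omega) h₃ h₄]
      simp only [sent_padded_castLE A P hT G x ω R, P.ofMsg_toMsg,
        add_tsub_cancel_left, add_sub_cancel_right, P.dec_enc]
    rw [sent_eq, sent_eq A]
    simp only [padded, h₁, h₂, dite_true, dite_false]
    refine congrArg (fun g => P.toMsg (P.enc (A.send u _ (x u) (ω u) ⟨i - s, h₂⟩ g _) + _)) ?_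
    funext j w
    exact hdec j w

theorem sent_padded_add (j : Fin r) {u v : V} (h : G.Adj u v) :
    (A.padded P hT).sent G x (A.padCoins P hT ω R) ⟨s + j, by omega⟩ u v h =
      P.toMsg (P.enc (A.sent G x ω j u v h) + P.extract (R u (Fintype.equivFin V v)) j) := by
  rw [sent_padded_of_sub_lt A P hT G x ω R (by simp) (by simp)]
  simp only [add_tsub_cancel_left]

theorem sent_padded_of_le {i : Fin T} (hi : s + r ≤ i) {u v : V} (h : G.Adj u v) :
    (A.padded P hT).sent G x (A.padCoins P hT ω R) i u v h = none := by
  rw [sent_eq]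
  have h₁ : ¬ i.val < s := by omega
  have h₂ : ¬ i.val - s < r := by omega
  simp only [padded, h₁, h₂, dite_false]

theorem outputs_padded :
    (A.padded P hT).outputs G x (A.padCoins P hT ω R) = A.outputs G x ω := by
  funext v
  change A.output _ _ _ _ _ = A.output _ _ _ _ _
  congr 1
  funext j z
  simp only [sent_padded_add A P hT G x ω R j, sent_padded_castLE A P hT G x ω R, P.ofMsg_toMsg,
    add_sub_cancel_right, P.dec_enc]

theorem indep_coin_padded : PMF.indep (A.padded P hT).coin =
    (PMF.indep A.coin).bind fun ω => (PMF.indep fun _ : V => PMF.uniformOfFintype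
      (Fin (Fintype.card V) → Fin s → K)).map (A.padCoins P hT ω) :=
  PMF.indep_bind_map_prodMk _ _

/-- The outputs agree for every choice of pads, so averaging over the pads changes nothing. -/
theorem outputLaw_padded : (A.padded P hT).outputLaw G x = A.outputLaw G x := by
  rw [outputLaw, indep_coin_padded, PMF.map_bind, outputLaw, ← PMF.bind_pure_comp]
  refine congrArg _ (funext fun ω => ?_)
  rw [PMF.map_comp, Function.comp_apply, ← PMF.map_const]
  exact congrArg (fun g => PMF.map g _) (funext fun R => outputs_padded A P hT G x ω R)

end CongestAlg

/-! ### Security of the compiled algorithm. -/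

namespace CongestAlg

variable {V : Type*} {I O : V → Type*} {B B' r s t T : ℕ} {K : Type}
variable [Fintype V] [AddCommGroup K] [Fintype K]

open Classical in
/-- The view of an eavesdropper on the compiled algorithm, as a function of its view `b` of the
messages of the original algorithm over the edges in `D` and of pads `R`. -/
noncomputable def padView (P : PadScheme B B' r s t K) {G : SimpleGraph V}
    (F : Fin T → Finset G.edgeSet) (D : Finset G.edgeSet)
    (b : Fin r → {d : G.Dart // (⟨d.edge, d.edge_mem⟩ : G.edgeSet) ∈ D} → Msg B)
    (R : V → Fin (Fintype.card V) → Fin s → K) :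
    ∀ i : Fin T, {d : G.Dart // (⟨d.edge, d.edge_mem⟩ : G.edgeSet) ∈ F i} → Msg B' :=
  fun i d =>
    if h₁ : i.val < s then P.toMsg (R d.1.fst (Fintype.equivFin V d.1.snd) ⟨i, h₁⟩)
    else if h₂ : i.val - s < r then
      -- Off `D` the plaintext becomes `0`: the translation moves it into the extracted key.
      P.toMsg ((if hD : _ then P.enc (b ⟨i - s, h₂⟩ ⟨d.1, hD⟩) else 0) +
        P.extract (R d.1.fst (Fintype.equivFin V d.1.snd)) ⟨i - s, h₂⟩)
    else none

variable (A : CongestAlg I O B r) (P : PadScheme B B' r s t K) (hT : s + r ≤ T)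
  {G : SimpleGraph V}

open Classical in
/-- If every edge outside `D` is observed in at most `t` of the first `s` rounds, then the
original messages over these edges are absorbed by a translation of the pads. -/
theorem exists_view_padded (F : Fin T → Finset G.edgeSet) (D : Finset G.edgeSet)
    (hD : ∀ e ∉ D, (Finset.univ.filter fun i : Fin s => e ∈ F ⟨i, by omega⟩).card ≤ t)
    (x : ∀ v, I v) (ω : ∀ v, A.Coin v) :
    ∃ δ : V → Fin (Fintype.card V) → Fin s → K, ∀ R,
      (A.padded P hT).view G F x (A.padCoins P hT ω R) =
        padView P F D (A.view G (fun _ => D) x ω) (R + δ) := by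
  have key : ∀ d : G.Dart, ∃ ρ : Fin s → K,
      (∀ i : Fin s, (⟨d.edge, d.edge_mem⟩ : G.edgeSet) ∈ F ⟨i, by omega⟩ → ρ i = 0) ∧
      P.extract ρ = if (⟨d.edge, d.edge_mem⟩ : G.edgeSet) ∈ D then 0 else
        fun j => P.enc (A.sent G x ω j d.fst d.snd d.adj) := by
    intro d
    split_ifs with h
    · exact ⟨0, fun _ _ => rfl, map_zero _⟩
    · obtain ⟨ρ, h₁, h₂⟩ := P.exists_extract_eq _ (hD _ h)
        fun j => P.enc (A.sent G x ω j d.fst d.snd d.adj)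
      exact ⟨ρ, fun i hi => h₁ i (by simpa using hi), h₂⟩
  choose δ hδ₁ hδ₂ using key
  -- Pads are indexed by all of `V`; those for non-neighbors are never sent, so `0` is harmless.
  refine ⟨fun u k => if h : G.Adj u ((Fintype.equivFin V).symm k) then δ ⟨(u, _), h⟩ else 0,
    fun R => ?_⟩
  funext i d
  obtain ⟨d, hd⟩ := d
  have hval : (if h : G.Adj d.fst ((Fintype.equivFin V).symm (Fintype.equivFin V d.snd)) then
      δ ⟨(d.fst, (Fintype.equivFin V).symm (Fintype.equivFin V d.snd)), h⟩ else 0) = δ d := by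
    simp
  simp only [view, padView, Pi.add_apply, hval]
  by_cases h₁ : i.val < s
  · rw [dif_pos h₁, hδ₁ d ⟨i, h₁⟩ hd, add_zero]
    exact sent_padded_castLE A P hT G x ω R ⟨i, h₁⟩ d.adj
  rw [dif_neg h₁]
  by_cases h₂ : i.val - s < r
  · rw [dif_pos h₂, sent_padded_of_sub_lt A P hT G x ω R h₁ h₂ d.adj, map_add, Pi.add_apply,
      hδ₂ d]
    congr 1
    split_ifs
    · simp
    · simp [add_comm]
  · rw [dif_neg h₂]
    exact sent_padded_of_le A P hT G x ω R (by omega) d.adj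

-- For fixed `ω` the translation `δ` preserves the uniform law of the pads. The input then enters
-- only through the static view on `D`.
open Classical in
theorem viewLaw_padded (F : Fin T → Finset G.edgeSet) (D : Finset G.edgeSet)
    (hD : ∀ e ∉ D, (Finset.univ.filter fun i : Fin s => e ∈ F ⟨i, by omega⟩).card ≤ t)
    (x : ∀ v, I v) :
    (A.padded P hT).viewLaw G F x = (A.viewLaw G (fun _ => D) x).bind fun b =>
      (PMF.indep fun _ : V => PMF.uniformOfFintype
        (Fin (Fintype.card V) → Fin s → K)).map (padView P F D b) := by
  rw [viewLaw, indep_coin_padded, PMF.map_bind, viewLaw, PMF.bind_map]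
  refine congrArg _ (funext fun ω => ?_)
  obtain ⟨δ, hδ⟩ := exists_view_padded A P hT F D hD x ω
  rw [Function.comp_apply, PMF.map_comp]
  conv_rhs => rw [← PMF.indep_uniform_map_add δ, PMF.map_comp]
  exact congrArg (fun g => PMF.map g _) (funext fun R => hδ R)

theorem card_edgeSet_finset_le (E : Finset G.edgeSet) : E.card ≤ Fintype.card V ^ 2 := by
  classical
  calc E.card ≤ Fintype.card G.edgeSet := Finset.card_le_univ E
    _ = G.edgeFinset.card := (Set.toFinset_card _).symm
    _ ≤ (Fintype.card V).choose 2 := G.card_edgeFinset_le_card_choose_two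
    _ ≤ Fintype.card V ^ 2 := Nat.choose_le_pow _ _

open Classical in
/-- Averaging: few edges are observed in more than `t` of the first `s` rounds. -/
theorem card_filter_lt_card_le {f g : ℕ} (F : Fin T → Finset G.edgeSet)
    (hF : ∀ i, (F i).card ≤ g) (hg : g * s < (t + 1) * (f + 1)) :
    (Finset.univ.filter fun e : G.edgeSet =>
      t < (Finset.univ.filter fun i : Fin s => e ∈ F ⟨i, by omega⟩).card).card ≤ f := by
  set D := Finset.univ.filter fun e : G.edgeSet =>
    t < (Finset.univ.filter fun i : Fin s => e ∈ F ⟨i, by omega⟩).card with hD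
  have h₁ : D.card * (t + 1) ≤
      ∑ e ∈ D, (Finset.univ.filter fun i : Fin s => e ∈ F ⟨i, by omega⟩).card := by
    rw [← smul_eq_mul]
    exact Finset.card_nsmul_le_sum _ _ _ fun e he => (Finset.mem_filter.1 he).2
  -- Double counting of pairs (edge, key round in which it is observed).
  have h₂ : ∑ e ∈ D, (Finset.univ.filter fun i : Fin s => e ∈ F ⟨i, by omega⟩).card =
      ∑ i : Fin s, (D.filter fun e => e ∈ F ⟨i, by omega⟩).card :=
    Finset.sum_card_bipartiteAbove_eq_sum_card_bipartiteBelow _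
  have h₃ : ∑ i : Fin s, (D.filter fun e => e ∈ F ⟨i, by omega⟩).card ≤ ∑ _i : Fin s, g :=
    Finset.sum_le_sum fun i _ => (Finset.card_le_card fun e he =>
      (Finset.mem_filter.1 he).2).trans (hF ⟨i, by omega⟩)
  rw [Finset.sum_const, Finset.card_univ, Fintype.card_fin, smul_eq_mul, mul_comm] at h₃
  by_contra! h
  have := Nat.mul_le_mul_left (t + 1) (Nat.succ_le_of_lt h)
  rw [Nat.succ_eq_add_one, mul_comm _ D.card] at this
  omega

theorem mobileSimulates_padded {f f' : ℕ}
    (hf : min f' (Fintype.card V ^ 2) * s < (t + 1) * (f + 1)) :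
    (A.padded P hT).MobileSimulates f' A f := by
  classical
  intro G X hA
  refine ⟨fun x _ => outputLaw_padded A P hT G x, fun F hF x₁ hx₁ x₂ hx₂ => ?_⟩
  have hD : ∀ e ∉ (Finset.univ.filter fun e : G.edgeSet =>
      t < (Finset.univ.filter fun i : Fin s => e ∈ F ⟨i, by omega⟩).card),
      (Finset.univ.filter fun i : Fin s => e ∈ F ⟨i, by omega⟩).card ≤ t := by
    intro e he
    simpa using he
  rw [viewLaw_padded A P hT F _ hD, viewLaw_padded A P hT F _ hD,
    hA _ (card_filter_lt_card_le hT F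
      (fun i => le_min (hF i) (card_edgeSet_finset_le _)) hf) x₁ hx₁ x₂ hx₂]

/-- Without any edge there is nothing to be hidden. -/
theorem exists_mobileSimulates_of_subsingleton {V : Type*} {I O : V → Type*} [Fintype V]
    [Subsingleton V] (A : CongestAlg I O B r) (B' T f f' : ℕ) :
    ∃ A' : CongestAlg I O B' T, A'.MobileSimulates f' A f := by
  refine ⟨⟨A.Coin, A.coin, fun _ _ _ _ _ _ _ => none,
    fun v N x c _ => A.output v N x c fun _ _ => none⟩, fun G X _ => ⟨fun x _ => ?_, ?_⟩⟩
  · refine congrArg (fun g => PMF.map g (PMF.indep A.coin)) ?_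
    funext ω v
    change A.output _ _ _ _ _ = A.output _ _ _ _ _
    congr 1
    funext i w
    exact (G.ne_of_adj w.2 (Subsingleton.elim _ _)).elim
  · intro F _ x₁ _ x₂ _
    refine congrArg (fun g => PMF.map g (PMF.indep A.coin)) ?_
    funext ω i d
    exact (G.ne_of_adj d.1.adj (Subsingleton.elim _ _)).elim

end CongestAlg

/-! ### Field size and bandwidth. -/

/-- Over a field with `p ≤ 2 ^ B'` elements, `p` a prime number larger than the number of
messages and the number of pads, Vandermonde extraction gives a one-time pad. -/
theorem nonempty_padScheme {B B' r t p : ℕ} [Fact p.Prime] (hB : 2 ^ B + 1 ≤ p)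
    (hs : r + t ≤ p) (hp : p ≤ 2 ^ B') : Nonempty (PadScheme B B' r (r + t) t (ZMod p)) := by
  obtain ⟨φ⟩ : Nonempty (Msg B ↪ ZMod p) :=
    Function.Embedding.nonempty_of_card_le (by simpa [Msg, ZMod.card] using hB)
  obtain ⟨ψ⟩ : Nonempty (ZMod p ↪ Msg B') :=
    Function.Embedding.nonempty_of_card_le (by simp [Msg, ZMod.card]; omega)
  have hα : Function.Injective fun i : Fin (r + t) => (i.val : ZMod p) := by
    intro i j hij
    have := congrArg ZMod.val hij
    rw [ZMod.val_natCast_of_lt (by omega), ZMod.val_natCast_of_lt (by omega)] at this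
    exact Fin.ext this
  exact ⟨{
    enc := φ
    dec := Function.invFun φ
    dec_enc := Function.leftInverse_invFun φ.injective
    toMsg := ψ
    ofMsg := Function.invFun ψ
    ofMsg_toMsg := Function.leftInverse_invFun ψ.injective
    extract :=
      { toFun := fun ρ j => ∑ i, ρ i * (i.val : ZMod p) ^ (j : ℕ)
        map_zero' := by ext; simp
        map_add' := fun a b => by ext; simp [add_mul, Finset.sum_add_distrib] }
    exists_extract_eq := fun S hS k => by
      obtain ⟨ρ, h₁, h₂⟩ := exists_vanishing_vandermonde hα hS k
      exact ⟨ρ, h₁, funext h₂⟩ }⟩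

theorem two_pow_le_card_pow {B c n : ℕ} (hn : n ≠ 0) (hB : (B : ℝ) ≤ c * Real.log n) :
    2 ^ B ≤ n ^ c := by
  have h : (2 : ℝ) ^ B ≤ (n : ℝ) ^ c := by
    rw [← Real.log_le_log_iff (by positivity) (by positivity), Real.log_pow, Real.log_pow]
    have : Real.log 2 ≤ 1 := Real.log_two_lt_d9.le.trans (by norm_num)
    nlinarith [Nat.cast_nonneg (α := ℝ) B]
  exact_mod_cast h

theorem le_mul_log_of_two_pow_le {B c n : ℕ} (hn : n ≠ 0) (h : 2 ^ B ≤ n ^ c) :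
    (B : ℝ) ≤ (2 * c : ℕ) * Real.log n := by
  have h' : (2 : ℝ) ^ B ≤ (n : ℝ) ^ c := by exact_mod_cast h
  rw [← Real.log_le_log_iff (by positivity) (by positivity), Real.log_pow, Real.log_pow] at h'
  have : 1 / 2 ≤ Real.log 2 := le_trans (by norm_num) Real.log_two_gt_d9.le
  push_cast
  nlinarith [Nat.cast_nonneg (α := ℝ) B]

/-- Prime fields of the size required for the pads have polynomially many elements. -/
theorem exists_prime_bandwidth {n c B r t : ℕ} (hn : 2 ≤ n) (hB : (B : ℝ) ≤ c * Real.log n)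
    (hr : r ≤ c * n ^ c) (ht : t ≤ 2 * n ^ 2 * r) :
    ∃ p B' : ℕ, p.Prime ∧ 2 ^ B + 1 ≤ p ∧ r + t ≤ p ∧ p ≤ 2 ^ B' ∧
      (B' : ℝ) ≤ (26 * c + 20 : ℕ) * Real.log n := by
  set M := 2 ^ B + 1 + r + t with hM
  have hpos : 0 < 2 ^ B := by positivity
  -- Bertrand's postulate.
  obtain ⟨p, hp, h₁, h₂⟩ := Nat.exists_prime_lt_and_le_two_mul M (by omega)
  refine ⟨p, Nat.log 2 (2 * M) + 1, hp, by omega, by omega,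
    h₂.trans (Nat.lt_pow_succ_log_self one_lt_two _).le, ?_⟩
  rw [show 26 * c + 20 = 2 * (13 * c + 10) by ring]
  refine le_mul_log_of_two_pow_le (by omega) ?_
  have h₃ : 2 ^ Nat.log 2 (2 * M) ≤ 2 * M := Nat.pow_log_le_self 2 (by omega)
  have h₄ := two_pow_le_card_pow (by omega) hB
  have h₅ : 1 ≤ n ^ c := Nat.one_le_pow _ _ (by omega)
  have h₆ : 1 ≤ n ^ 2 := Nat.one_le_pow _ _ (by omega)
  have h₇ : 2 * n ^ 2 * r ≤ 2 * n ^ 2 * (c * n ^ c) := Nat.mul_le_mul_left _ hr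
  have h₈ : n ^ c ≤ n ^ 2 * n ^ c := Nat.le_mul_of_pos_left _ h₆
  have h₉ : c * n ^ c ≤ c * (n ^ 2 * n ^ c) := Nat.mul_le_mul_left _ h₈
  calc 2 ^ (Nat.log 2 (2 * M) + 1) ≤ 4 * M := by rw [pow_succ]; omega
    _ ≤ (12 * c + 8) * (n ^ 2 * n ^ c) := by
      rw [hM]
      linarith
    -- A constant factor `a` is at most `2 ^ a`, hence at most `n ^ a`.
    _ ≤ n ^ (12 * c + 8) * (n ^ 2 * n ^ c) := by
      refine Nat.mul_le_mul_right _ (Nat.lt_two_pow_self.le.trans ?_)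
      exact Nat.pow_le_pow_left hn _
    _ = n ^ (13 * c + 10) := by ring

namespace CongestAlg

/-- The general compiler: with `t` extra key exchange rounds, an algorithm that is secure against
`f` static edges becomes secure against `f'` mobile edges whenever `f' * (r + t)` observations
cannot reveal the keys of more than `f` edges. -/
theorem exists_mobileSimulates {V : Type*} [Fintype V] {I O : V → Type*} {c B r f f' t : ℕ}
    (hB : (B : ℝ) ≤ c * Real.log (Fintype.card V)) (hr : r ≤ c * Fintype.card V ^ c)
    (A : CongestAlg I O B r) (h₁ : f' * (r + t) < (t + 1) * (f + 1)) (h₂ : r = 0 ∨ f' ≤ f) :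
    ∃ B' : ℕ, (B' : ℝ) ≤ (26 * c + 20 : ℕ) * Real.log (Fintype.card V) ∧
      ∃ A' : CongestAlg I O B' (2 * r + t), A'.MobileSimulates f' A f := by
  rcases le_or_gt (Fintype.card V) 1 with hV | hV
  · have := Fintype.card_le_one_iff_subsingleton.1 hV
    refine ⟨0, ?_, exists_mobileSimulates_of_subsingleton A _ _ _ _⟩
    rw [Nat.cast_zero]
    exact mul_nonneg (Nat.cast_nonneg _) (Real.log_natCast_nonneg _)
  set n := Fintype.card V with hn
  -- Only `t₀` extra key rounds are used, and the surplus rounds are silent. This keeps the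
  -- bandwidth independent of `t`.
  obtain ⟨t₀, ht, ht₀, hf⟩ : ∃ t₀ ≤ t, t₀ ≤ 2 * n ^ 2 * r ∧
      min f' (n ^ 2) * (r + t₀) < (t₀ + 1) * (f + 1) := by
    rcases le_or_gt t (2 * n ^ 2 * r) with h | h
    · exact ⟨t, le_rfl, h, (Nat.mul_le_mul_right _ (min_le_left _ _)).trans_lt h₁⟩
    · refine ⟨2 * n ^ 2 * r, h.le, le_rfl, ?_⟩
      rcases h₂ with rfl | h₂
      · simp
      have h₃ := Nat.mul_le_mul_right r (min_le_right f' (n ^ 2))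
      have h₄ := Nat.mul_le_mul_right (2 * n ^ 2 * r) ((min_le_left f' (n ^ 2)).trans h₂)
      nlinarith
  obtain ⟨p, B', hp, hp₁, hp₂, hp₃, hB'⟩ := exists_prime_bandwidth hV hB hr ht₀
  have := Fact.mk hp
  obtain ⟨P⟩ := nonempty_padScheme (t := t₀) hp₁ hp₂ hp₃
  exact ⟨B', hB', A.padded P (by omega), mobileSimulates_padded A P _ hf⟩

end CongestAlg

theorem mainTheorem4 :
    -- `K` is the absolute constant in the bounds `O(r)`, `Θ(f)`, `O(fr)`
    ∃ K : ℕ, 0 < K ∧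
    -- message sizes `O(log n)` and round bounds `poly(n)`, with arbitrary constants `c`
    ∀ c : ℕ, ∃ c' : ℕ,
    ∀ {V : Type*} [Fintype V] (I O : V → Type*) (B r f : ℕ),
      (B : ℝ) ≤ c * Real.log (Fintype.card V) → r ≤ c * Fintype.card V ^ c →
      ∀ A : CongestAlg I O B r,
        (∀ t : ℕ, 1 ≤ t → ∃ B' : ℕ, (B' : ℝ) ≤ c' * Real.log (Fintype.card V) ∧
          ∃ A' : CongestAlg I O B' (2 * r + t),
            A'.MobileSimulates (f * (t + 1) / (r + t)) A f) ∧
        (∀ t : ℕ, 2 * f * r ≤ t → ∃ B' : ℕ, (B' : ℝ) ≤ c' * Real.log (Fintype.card V) ∧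
          ∃ A' : CongestAlg I O B' (2 * r + t), A'.MobileSimulates f A f) ∧
        (∃ r' f' B' : ℕ, r' ≤ K * r ∧ f ≤ K * f' ∧ f' ≤ K * f ∧
          (B' : ℝ) ≤ c' * Real.log (Fintype.card V) ∧
          ∃ A' : CongestAlg I O B' r', A'.MobileSimulates f' A f) ∧
        (1 ≤ f → ∃ r' B' : ℕ, r' ≤ K * (f * r) ∧
          (B' : ℝ) ≤ c' * Real.log (Fintype.card V) ∧
          ∃ A' : CongestAlg I O B' r', A'.MobileSimulates f A f) := by
  refine ⟨4, by norm_num, fun c => ⟨26 * c + 20, ?_⟩⟩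
  intro V _ I O B r f hB hr A
  have hlong : ∀ t : ℕ, 2 * f * r ≤ t → ∃ B' : ℕ,
      (B' : ℝ) ≤ (26 * c + 20 : ℕ) * Real.log (Fintype.card V) ∧
        ∃ A' : CongestAlg I O B' (2 * r + t), A'.MobileSimulates f A f :=
    fun t ht => CongestAlg.exists_mobileSimulates hB hr A (by nlinarith) (Or.inr le_rfl)
  refine ⟨fun t ht => ?_, hlong, ?_, fun hf => ?_⟩
  · refine CongestAlg.exists_mobileSimulates hB hr A ?_ ?_
    · have := Nat.div_mul_le_self (f * (t + 1)) (r + t)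
      nlinarith
    -- For `r = 0` the quotient can exceed `f`, hence the alternative `r = 0`.
    · rcases Nat.eq_zero_or_pos r with h | h
      · exact Or.inl h
      · refine Or.inr (Nat.div_le_of_le_mul ?_)
        rw [mul_comm]
        exact Nat.mul_le_mul_right _ (by omega)
  -- For `f = 1` halving would give `0`, which is not `Θ(f)`; but then `2 * f * r` is already
  -- `O(r)`.
  · rcases le_or_gt f 1 with hf | hf
    · obtain ⟨B', hB', hA'⟩ := hlong (2 * f * r) le_rfl
      exact ⟨_, f, B', by nlinarith, by omega, by omega, hB', hA'⟩
    · obtain ⟨B', hB', hA'⟩ := CongestAlg.exists_mobileSimulates (f' := f / 2) (t := 2 * r)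
        (f := f) hB hr A (by nlinarith [Nat.div_mul_le_self f 2]) (Or.inr (Nat.div_le_self f 2))
      exact ⟨_, f / 2, B', by omega, by omega, by omega, hB', hA'⟩
  · obtain ⟨B', hB', hA'⟩ := hlong (2 * f * r) le_rfl
    exact ⟨_, B', by nlinarith, hB', hA'⟩
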